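/- Let $(i,H,B)$ be an abstract Wiener space: $H$ is a real separable Hilbert space, $i:H\to B$ is a continuous injection with dense range into a separable real Banach space $B$, and for $t>0$ there is a Borel probability measure $\mu_{B,t}$ on $B$ such that every $L\in B'$ is a centred Gaussian variable of variance $t\,|i^*L|^2$, where $i^*:B'\to H'=H$ identifies $B'$ with a dense subspace of $H$. Then $(i\times i,H^2,B^2)$ is an abstract Wiener space with measures $\mu_{B^2,t}=\mu_{B,t}\otimes\mu_{B,t}$. For $a\in H^2$ let $\ell_a\in L^2(B^2,\mu_{B^2,t})$ be the $L^2$-limit of functionals $L\in (B^2)'\subset H^2$ as $L\to a$ in $H^2$, and for a finite-dimensional subspace $E\subset H^2$ with orthonormal basis $(w_k)$ let $P_E(Y)=\sum_k \ell_{w_k}(Y)\,w_k$ for a.e. $Y\in B^2$. A function $\Phi:H^2\to\mathbf C$ has the stochastic extension $\widetilde \Phi\in L^1(B^2,\mu_{B^2,t})$ if, for every increasing sequence $(E_n)$ of finite-dimensional subspaces of $H^2$ with dense union, the functions $\Phi\circ P_{E_n}$ belong to $L^1(B^2,\mu_{B^2,t})$ and converge to $\widetilde \Phi$ in $L^1(B^2,\mu_{B^2,t})$;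 it is then unique almost everywhere. The heat operator is $$(H_tF)(X)=\int_{B^2}\widetilde F(X+Y)\,d\mu_{B^2,t}(Y),\qquad X\in H^2,\ t>0,$$ where $\widetilde F(X+\cdot)$ denotes the stochastic extension of $H^2\ni Y\mapsto F(X+Y)$. Let $(e_j)_{j\in\Gamma}$ be a Hilbert basis of $H$ with $\Gamma$ countable and $e_j\in B'$ for all $j$, and put $u_j=(e_j,0)$, $v_j=(0,e_j)$. For $M\ge 0$, $m\in\mathbf N$ and nonnegative reals $\varepsilon=(\varepsilon_j)_{j\in\Gamma}$, let $S_m(M,\varepsilon)$ be the set of bounded continuous $F:H^2\to\mathbf C$ such that, for all finitely supported $\alpha,\beta:\Gamma\to\mathbf N$ with $\alpha_j\le m$ and $\beta_j\le m$ for all $j$, the derivative $\partial_x^\alpha\partial_\xi^\beta F=\big[\prod_j\partial_{u_j}^{\alpha_j}\partial_{v_j}^{\beta_j}\big]F$ exists (in any order of differentiation), is continuous on $H^2$, and satisfies $|\partial_x^\alpha\partial_\xi^\beta F(X)|\le M\prod_j\varepsilon_j^{\alpha_j+\beta_j}$ for all $X\in H^2$. **Proposition.** Let $F\in S_4(M,\varepsilon)$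 with $\sum_{j\in\Gamma}\varepsilon_j<\infty$. Then, for every $X\in H^2$ and $t\in(0,1)$, the function $Y\mapsto F(X+Y)$ has a stochastic extension in $L^1(B^2,\mu_{B^2,t})$, so that $(H_tF)(X)$ is well defined, and there exists $C>0$ such that $$|(H_tF)(X)-F(X)|\le C\,t\qquad\text{for all } X\in H^2 \text{ and } t\in(0,1).$$ -/

import Mathlib

open MeasureTheory Filter Topology
open scoped ENNReal RealInnerProductSpace

noncomputable section

/-- An abstract Wiener space `(i, H, B)`: a real Hilbert space `H` embedded continuously, injectively
and densely in a Banach space `B` on which the canonical Gaussian cylinder measure of `H` extends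
to a genuine measure `wiener` (variance `1`), i.e. a probability measure on `B` under which every
`L ∈ B'` is a centred Gaussian variable of variance `|i* L|²` (the norm of `L` restricted to `H`).
Such a measure is unique. -/
structure AbstractWienerSpace (H B : Type*) [NormedAddCommGroup H] [InnerProductSpace ℝ H]
    [NormedAddCommGroup B] [NormedSpace ℝ B] [MeasurableSpace B] where
  incl : H →L[ℝ] B
  incl_injective : Function.Injective incl
  incl_denseRange : DenseRange incl
  wiener : Measure B
  isProbabilityMeasure : IsProbabilityMeasure wiener
  charFunDual_wiener : ∀ L : StrongDual ℝ B,
    charFunDual wiener L = Complex.exp (-((‖L.comp incl‖ ^ 2 : ℝ) : ℂ) / 2)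

namespace AbstractWienerSpace

section Basic

variable {H B : Type*} [NormedAddCommGroup H] [InnerProductSpace ℝ H] [CompleteSpace H]
  [NormedAddCommGroup B] [NormedSpace ℝ B] [MeasurableSpace B]

/-- The inclusion `B' ⊂ H' = H` (the Riesz identification). -/
def dualEmb (W : AbstractWienerSpace H B) (L : StrongDual ℝ B) : H :=
  (InnerProductSpace.toDual ℝ H).symm (L.comp W.incl)

/-- The Gaussian measure `μ_{B,t}` of variance `t`. -/
def gaussian (W : AbstractWienerSpace H B) (t : ℝ) : Measure B :=
  W.wiener.map (fun y => √t • y)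

theorem charFunDual_gaussian [BorelSpace B] (W : AbstractWienerSpace H B) {t : ℝ} (ht : 0 ≤ t)
    (L : StrongDual ℝ B) :
    charFunDual (W.gaussian t) L = Complex.exp (-((t * ‖W.dualEmb L‖ ^ 2 : ℝ) : ℂ) / 2) := by
  have h1 : W.gaussian t = W.wiener.map (√t • ContinuousLinearMap.id ℝ B) := rfl
  have h2 : (L.comp (√t • ContinuousLinearMap.id ℝ B)).comp W.incl = √t • L.comp W.incl := by
    ext x; simp
  rw [h1, charFunDual_map, W.charFunDual_wiener, h2, norm_smul, mul_pow, Real.norm_eq_abs, sq_abs,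
    Real.sq_sqrt ht, dualEmb, LinearIsometryEquiv.norm_map]

/-- The variable `ℓ_a ∈ L²(B, μ_{B,t})` of `a ∈ H`: the limit of the classes of `L ∈ B'` as
`L → a` in `H`.  (The map sending `L`, seen as an element of `H`, to its class is `√t` times an
isometry defined on the dense subspace `B'` of `H`, so that the limit exists.) -/
def ell [OpensMeasurableSpace B] (W : AbstractWienerSpace H B) (t : ℝ) (a : H) :
    Lp ℝ 2 (W.gaussian t) :=
  limUnder (comap W.dualEmb (𝓝 a)) (StrongDual.toLp (W.gaussian t) 2)

/-- The extension `P_E(y) = ∑ ℓ_{u_j}(y) u_j` to `B` of the orthogonal projection onto a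
finite-dimensional subspace `E` of `H`, where `(u_j)` is an orthonormal basis of `E`
(up to null sets it does not depend on the basis). -/
def proj [OpensMeasurableSpace B] (W : AbstractWienerSpace H B) (t : ℝ) (E : Submodule ℝ H)
    [FiniteDimensional ℝ E] (y : B) : H :=
  ∑ j, (W.ell t (stdOrthonormalBasis ℝ E j : H)) y • (stdOrthonormalBasis ℝ E j : H)

/-- `G` is the stochastic extension in `L¹(B, μ_{B,t})` of the function `F` on `H`: for every
increasing sequence `(E_n)` of finite-dimensional subspaces of `H` with dense union, the functions
`F ∘ P_{E_n}` are in `L¹(B, μ_{B,t})` and converge to `G` in `L¹(B, μ_{B,t})`. -/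
def IsStochasticExtension [OpensMeasurableSpace B] (W : AbstractWienerSpace H B) (t : ℝ)
    (F : H → ℂ) (G : B → ℂ) : Prop :=
  MemLp G 1 (W.gaussian t) ∧
  ∀ (E : ℕ → Submodule ℝ H) [∀ n, FiniteDimensional ℝ (E n)], Monotone E →
    Dense (⋃ n, (E n : Set H)) →
      (∀ n, MemLp (fun y => F (W.proj t (E n) y)) 1 (W.gaussian t)) ∧
      Tendsto (fun n => eLpNorm (fun y => F (W.proj t (E n) y) - G y) 1 (W.gaussian t)) atTop (𝓝 0)

/-- The stochastic extension is unique up to null sets. -/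
theorem IsStochasticExtension.ae_eq [OpensMeasurableSpace B] [TopologicalSpace.SeparableSpace H]
    {W : AbstractWienerSpace H B} {t : ℝ} {F : H → ℂ} {G G' : B → ℂ}
    (h : W.IsStochasticExtension t F G) (h' : W.IsStochasticExtension t F G') :
    G =ᵐ[W.gaussian t] G' := by
  let E : ℕ → Submodule ℝ H := fun n =>
    Submodule.span ℝ (TopologicalSpace.denseSeq H '' Set.Iic n)
  have : ∀ n, FiniteDimensional ℝ (E n) := fun n =>
    FiniteDimensional.span_of_finite ℝ ((Set.finite_Iic n).image _)
  have hE : Monotone E := fun a b hab =>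
    Submodule.span_mono (Set.image_mono (Set.Iic_subset_Iic.2 hab))
  have hd : Dense (⋃ n, (E n : Set H)) := by
    refine (TopologicalSpace.denseRange_denseSeq H).mono ?_
    rintro _ ⟨n, rfl⟩
    exact Set.mem_iUnion.2 ⟨n, Submodule.subset_span ⟨n, Set.mem_Iic.2 le_rfl, rfl⟩⟩
  obtain ⟨hm, hG⟩ := h.2 E hE hd
  obtain ⟨-, hG'⟩ := h'.2 E hE hd
  have hz : eLpNorm (G - G') 1 (W.gaussian t) = 0 := by
    have hs := hG.add hG'
    rw [add_zero] at hs
    refine le_antisymm (ge_of_tendsto' hs fun n => ?_) zero_le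
    have he : G - G' = (fun y => F (W.proj t (E n) y) - G' y)
        - fun y => F (W.proj t (E n) y) - G y := by
      ext y; simp
    rw [he, add_comm]
    exact eLpNorm_sub_le ((hm n).sub h'.1).1 ((hm n).sub h.1).1 le_rfl
  have := (eLpNorm_eq_zero_iff (h.1.sub h'.1).1 one_ne_zero).1 hz
  filter_upwards [this] with y hy
  exact sub_eq_zero.1 hy

open Classical in
/-- The heat operator `(H_t F)(X) = ∫_B F~(X + Y) dμ_{B,t}(Y)`, where `F~(X + ·)` is the stochastic
extension in `L¹(B, μ_{B,t})` of `Y ↦ F(X + Y)` (and `0` by convention if there is none). -/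
def heatOp [OpensMeasurableSpace B] (W : AbstractWienerSpace H B) (t : ℝ) (F : H → ℂ) (X : H) : ℂ :=
  if h : ∃ G : B → ℂ, W.IsStochasticExtension t (fun Y => F (X + Y)) G then
    ∫ y, h.choose y ∂(W.gaussian t)
  else 0

theorem heatOp_eq [OpensMeasurableSpace B] [TopologicalSpace.SeparableSpace H]
    {W : AbstractWienerSpace H B} {t : ℝ} {F : H → ℂ} {X : H} {G : B → ℂ}
    (hG : W.IsStochasticExtension t (fun Y => F (X + Y)) G) :
    W.heatOp t F X = ∫ y, G y ∂(W.gaussian t) := by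
  have h : ∃ G : B → ℂ, W.IsStochasticExtension t (fun Y => F (X + Y)) G := ⟨G, hG⟩
  rw [heatOp, dif_pos h]
  exact integral_congr_ae (h.choose_spec.ae_eq hG)

end Basic

section Square

variable {H B : Type*} [NormedAddCommGroup H] [InnerProductSpace ℝ H] [CompleteSpace H]
  [NormedAddCommGroup B] [NormedSpace ℝ B] [MeasurableSpace B]

/-- The abstract Wiener space `(i × i, H², B²)`, with `H²` the Hilbert sum and with the product
measure. -/
def sq (W : AbstractWienerSpace H B) : AbstractWienerSpace (WithLp 2 (H × H)) (B × B) where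
  incl := (W.incl.prodMap W.incl).comp
    (WithLp.prodContinuousLinearEquiv 2 ℝ H H).toContinuousLinearMap
  incl_injective := by
    have h := W.incl_injective.prodMap W.incl_injective
    exact h.comp (WithLp.prodContinuousLinearEquiv 2 ℝ H H).injective
  incl_denseRange := by
    have h := W.incl_denseRange.prodMap W.incl_denseRange
    exact h.comp (WithLp.prodContinuousLinearEquiv 2 ℝ H H).surjective.denseRange
      (W.incl.prodMap W.incl).continuous
  wiener := W.wiener.prod W.wiener
  isProbabilityMeasure := by
    have := W.isProbabilityMeasure
    infer_instance
  charFunDual_wiener L := by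
    have := W.isProbabilityMeasure
    rw [charFunDual_prod, W.charFunDual_wiener, W.charFunDual_wiener, ← Complex.exp_add]
    congr 1
    set L₁ := (L.comp (ContinuousLinearMap.inl ℝ B B)).comp W.incl with hL₁
    set L₂ := (L.comp (ContinuousLinearMap.inr ℝ B B)).comp W.incl with hL₂
    have key : L.comp ((W.incl.prodMap W.incl).comp
        (WithLp.prodContinuousLinearEquiv 2 ℝ H H).toContinuousLinearMap)
        = InnerProductSpace.toDual ℝ (WithLp 2 (H × H)) (WithLp.toLp 2
          ((InnerProductSpace.toDual ℝ H).symm L₁, (InnerProductSpace.toDual ℝ H).symm L₂)) := by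
      ext x
      simp only [InnerProductSpace.toDual_apply_apply, WithLp.prod_inner_apply,
        InnerProductSpace.toDual_symm_apply, hL₁, hL₂, ContinuousLinearMap.comp_apply,
        ContinuousLinearMap.inl_apply, ContinuousLinearMap.inr_apply, ← map_add]
      simp [Prod.map]
    rw [key, LinearIsometryEquiv.norm_map, WithLp.prod_norm_sq_eq_of_L2]
    rw [WithLp.toLp_fst, WithLp.toLp_snd, LinearIsometryEquiv.norm_map,
      LinearIsometryEquiv.norm_map]
    push_cast
    ring

end Square

end AbstractWienerSpace

section Symbols

variable {H : Type*} [NormedAddCommGroup H] [InnerProductSpace ℝ H] {Γ : Type*}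

/-- The directions `u_j = (e_j, 0)` (`Sum.inl j`) and `v_j = (0, e_j)` (`Sum.inr j`) of `H²`. -/
def phaseDir (e : HilbertBasis Γ ℝ H) : Γ ⊕ Γ → WithLp 2 (H × H)
  | Sum.inl j => WithLp.toLp 2 (e j, 0)
  | Sum.inr j => WithLp.toLp 2 (0, e j)

/-- The iterated derivative of `F` in the directions of the list `l` (last entry first). -/
def iterDeriv (e : HilbertBasis Γ ℝ H) (F : WithLp 2 (H × H) → ℂ) :
    List (Γ ⊕ Γ) → WithLp 2 (H × H) → ℂ
  | [] => F
  | k :: l => fun X => lineDeriv ℝ (iterDeriv e F l) X (phaseDir e k)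

/-- All the successive derivatives in `iterDeriv e F l` exist, at every point. -/
def IterDifferentiable (e : HilbertBasis Γ ℝ H) (F : WithLp 2 (H × H) → ℂ) :
    List (Γ ⊕ Γ) → Prop
  | [] => True
  | k :: l => IterDifferentiable e F l ∧
      ∀ X, LineDifferentiableAt ℝ (iterDeriv e F l) X (phaseDir e k)

open Classical in
/-- The class `S_m(M, ε)`: for all multi-indices `(α, β)` with `α_j ≤ m` and `β_j ≤ m`, the
derivative `∂_x^α ∂_ξ^β F` (taken in any order: `l` lists each `u_j` exactly `α_j` times and each
`v_j` exactly `β_j` times) exists, is continuous on `H²`, and is bounded by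
`M ∏_j ε_j ^ (α_j + β_j)`.  For `α = β = 0` this says that `F` is continuous and bounded by `M`. -/
def SymbolClass (e : HilbertBasis Γ ℝ H) (m : ℕ) (M : ℝ) (ε : Γ → ℝ) :
    Set (WithLp 2 (H × H) → ℂ) :=
  {F | ∀ α β : Γ →₀ ℕ, (∀ j, α j ≤ m ∧ β j ≤ m) →
    ∀ l : List (Γ ⊕ Γ), (∀ j, l.count (Sum.inl j) = α j ∧ l.count (Sum.inr j) = β j) →
      IterDifferentiable e F l ∧ Continuous (iterDeriv e F l) ∧
      ∀ X, ‖iterDeriv e F l X‖ ≤ M * (α + β).prod fun j n => ε j ^ n}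

end Symbols

end

/-! In the coordinates of the Hilbert basis `(u_j), (v_j)` of `H²`, indexed by `k`, the function `F`
is Lipschitz in each coordinate with constant `M ε_k`, and its second derivative there is at most `M
ε_k²`; both families are summable.

Existence of the extension: the `k`-th coordinate of `P_E Y - P_{E'} Y` is `ℓ_a` with `a = P_E b_k -
P_{E'} b_k`, whose `L¹` norm is at most `√t |a|`. Hence `F(X + P_E Y) - F(X + P_{E'} Y)` has `L¹`
norm at most `∑ M ε_k √t |P_E b_k - P_{E'} b_k|` (`eLpNorm_comp_proj_sub_le`), and dominated
convergence makes this small as both projections tend strongly to the identity. A reference sequence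
is therefore Cauchy, and every other sequence has the same limit.

The bound: along spans of finitely many basis vectors, `P_E Y` is a sum of Gaussian coordinates,
added one at a time. In a Taylor expansion in the new coordinate the linear term integrates to zero
by reflection symmetry (`integral_dual_smul_eq_zero`), and the remainder is at most `M ε_k²` times
the square of a variable of variance `t`. Summing gives `t ∑ M ε_k²`, uniformly in the subspace, and
the bound survives the `L¹` limit. -/

namespace AbstractWienerSpace

/-! ### Gaussian variables on `B` and the map `a ↦ ℓ_a` -/

section Gaussian

open ProbabilityTheory

variable {H B : Type*} [NormedAddCommGroup H] [InnerProductSpace ℝ H] [CompleteSpace H]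
  [NormedAddCommGroup B] [NormedSpace ℝ B] [MeasurableSpace B] [BorelSpace B]

instance isProbabilityMeasure_gaussian (W : AbstractWienerSpace H B) (t : ℝ) :
    IsProbabilityMeasure (W.gaussian t) := by
  have := W.isProbabilityMeasure
  exact Measure.isProbabilityMeasure_map (by fun_prop)

omit [BorelSpace B] in
theorem inner_dualEmb (W : AbstractWienerSpace H B) (L : StrongDual ℝ B) (x : H) :
    ⟪W.dualEmb L, x⟫ = L (W.incl x) := by
  simp [dualEmb]

/-- The identification `B' ⊂ H` as a linear map. -/
noncomputable def dualEmbₗ (W : AbstractWienerSpace H B) : StrongDual ℝ B →ₗ[ℝ] H where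
  toFun := W.dualEmb
  map_add' L L' := ext_inner_right ℝ fun x => by simp [inner_add_left, inner_dualEmb]
  map_smul' c L := ext_inner_right ℝ fun x => by simp [inner_smul_left, inner_dualEmb]

omit [BorelSpace B] in
@[simp] theorem dualEmbₗ_apply (W : AbstractWienerSpace H B) (L : StrongDual ℝ B) :
    W.dualEmbₗ L = W.dualEmb L := rfl

omit [BorelSpace B] in
-- A vector `x` orthogonal to the range satisfies `L (i x) = 0` for all `L ∈ B'`, so `i x = 0` by
-- Hahn–Banach and `x = 0` by injectivity of `i`.
theorem denseRange_dualEmb (W : AbstractWienerSpace H B) : DenseRange W.dualEmb := by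
  have h : Dense (LinearMap.range W.dualEmbₗ : Set H) := by
    rw [Submodule.dense_iff_topologicalClosure_eq_top, Submodule.topologicalClosure_eq_top_iff,
      Submodule.eq_bot_iff]
    intro x hx
    refine W.incl_injective ?_
    rw [map_zero]
    refine SeparatingDual.eq_zero_of_forall_dual_eq_zero (R := ℝ) fun L => ?_
    rw [← W.inner_dualEmb]
    exact hx _ ⟨L, rfl⟩
  exact h

theorem map_dual_gaussian (W : AbstractWienerSpace H B) {t : ℝ} (ht : 0 ≤ t)
    (L : StrongDual ℝ B) :
    (W.gaussian t).map L = gaussianReal 0 (t * ‖W.dualEmb L‖ ^ 2).toNNReal := by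
  have := Measure.isProbabilityMeasure_map (μ := W.gaussian t) (f := L) (by fun_prop)
  refine Measure.ext_of_charFun (funext fun u => ?_)
  rw [charFun_map_eq_charFunDual_smul, W.charFunDual_gaussian ht, charFun_gaussianReal]
  have : W.dualEmb (u • L) = u • W.dualEmb L := W.dualEmbₗ.map_smul u L
  rw [this, norm_smul, mul_pow, Real.norm_eq_abs, sq_abs, Real.coe_toNNReal _ (by positivity)]
  congr 1
  push_cast
  ring

theorem isGaussian_gaussian (W : AbstractWienerSpace H B) {t : ℝ} (ht : 0 ≤ t) :
    IsGaussian (W.gaussian t) :=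
  isGaussian_of_map_eq_gaussianReal fun L => ⟨0, _, W.map_dual_gaussian ht L⟩

theorem integral_dual_gaussian_sq (W : AbstractWienerSpace H B) {t : ℝ} (ht : 0 ≤ t)
    (L : StrongDual ℝ B) : ∫ y, L y ^ 2 ∂(W.gaussian t) = t * ‖W.dualEmb L‖ ^ 2 := by
  have h : ∫ x, x ^ 2 ∂((W.gaussian t).map L) = ∫ y, L y ^ 2 ∂(W.gaussian t) :=
    integral_map (by fun_prop) (by fun_prop)
  have hv := variance_id_gaussianReal (μ := 0) (v := (t * ‖W.dualEmb L‖ ^ 2).toNNReal)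
  rw [variance_of_integral_eq_zero (by fun_prop) (by simp [integral_id_gaussianReal])] at hv
  rw [← h, W.map_dual_gaussian ht]
  simpa [Real.coe_toNNReal _ (by positivity : 0 ≤ t * ‖W.dualEmb L‖ ^ 2)] using hv

variable [CompleteSpace B] [SecondCountableTopology B]

theorem memLp_id_gaussian (W : AbstractWienerSpace H B) {t : ℝ} (ht : 0 ≤ t) :
    MemLp id 2 (W.gaussian t) :=
  have := W.isGaussian_gaussian ht
  IsGaussian.memLp_id _ 2 (by simp)

theorem memLp_dual_gaussian (W : AbstractWienerSpace H B) {t : ℝ} (ht : 0 ≤ t)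
    (L : StrongDual ℝ B) : MemLp L 2 (W.gaussian t) :=
  (W.memLp_id_gaussian ht).continuousLinearMap_comp L

theorem norm_toLp_gaussian (W : AbstractWienerSpace H B) {t : ℝ} (ht : 0 ≤ t)
    (L : StrongDual ℝ B) :
    ‖StrongDual.toLp (W.gaussian t) 2 L‖ = √t * ‖W.dualEmb L‖ := by
  refine (sq_eq_sq₀ (norm_nonneg _) (by positivity)).1 ?_
  rw [mul_pow, Real.sq_sqrt ht, ← W.integral_dual_gaussian_sq ht,
    StrongDual.toLp_apply (W.memLp_id_gaussian ht), ← real_inner_self_eq_norm_sq, L2.inner_def]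
  refine integral_congr_ae ?_
  filter_upwards [MemLp.coeFn_toLp (W.memLp_dual_gaussian ht L)] with y hy
  rw [hy]
  simp

/-- `limUnder` is meaningful only if the limit exists. It does: by `norm_toLp_gaussian` the map is
`√t` times an isometry in the norm of `H`, so its image of the filter is Cauchy. -/
theorem tendsto_ell (W : AbstractWienerSpace H B) {t : ℝ} (ht : 0 ≤ t) (a : H) :
    Tendsto (StrongDual.toLp (W.gaussian t) 2) (comap W.dualEmb (𝓝 a)) (𝓝 (W.ell t a)) := by
  have hne : (comap W.dualEmb (𝓝 a)).NeBot := comap_neBot fun s hs => by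
    obtain ⟨_, hx, L, rfl⟩ := mem_closure_iff_nhds.1 (W.denseRange_dualEmb a) s hs
    exact ⟨L, hx⟩
  refine tendsto_nhds_limUnder (cauchy_map_iff_exists_tendsto.1 ?_)
  rw [Metric.cauchy_iff]
  refine ⟨inferInstance, fun δ hδ => ?_⟩
  -- Two points within `r` of `a` are at most `2r` apart; the `+ 1` in the witness covers `t = 0`.
  obtain ⟨r, hr, hrδ⟩ : ∃ r > 0, √t * (2 * r) < δ := by
    refine ⟨δ / (2 * (√t + 1)), by positivity, ?_⟩
    have : √t * (2 * (δ / (2 * (√t + 1)))) = δ * (√t / (√t + 1)) := by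
      field_simp
    rw [this]
    have : √t / (√t + 1) < 1 := (div_lt_one (by positivity)).2 (by linarith)
    nlinarith
  refine ⟨_, image_mem_map (preimage_mem_comap (Metric.ball_mem_nhds a hr)), ?_⟩
  rintro _ ⟨L, hL, rfl⟩ _ ⟨L', hL', rfl⟩
  rw [dist_eq_norm, ← map_sub, W.norm_toLp_gaussian ht]
  refine lt_of_le_of_lt ?_ hrδ
  gcongr
  have : W.dualEmb (L - L') = W.dualEmb L - W.dualEmb L' := W.dualEmbₗ.map_sub L L'
  rw [this, ← dist_eq_norm, two_mul]
  exact (dist_triangle_right _ _ a).trans (add_le_add (le_of_lt hL) (le_of_lt hL'))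

omit [BorelSpace B] [CompleteSpace B] [SecondCountableTopology B] in
theorem exists_seq_dualEmb_tendsto (W : AbstractWienerSpace H B) (a : H) :
    ∃ L : ℕ → StrongDual ℝ B, Tendsto (fun n => W.dualEmb (L n)) atTop (𝓝 a) := by
  obtain ⟨x, hx, hxa⟩ := mem_closure_iff_seq_limit.1 (W.denseRange_dualEmb a)
  choose L hL using hx
  exact ⟨L, by simpa [hL] using hxa⟩

theorem tendsto_toLp_ell (W : AbstractWienerSpace H B) {t : ℝ} (ht : 0 ≤ t) {a : H}
    {L : ℕ → StrongDual ℝ B} (hL : Tendsto (fun n => W.dualEmb (L n)) atTop (𝓝 a)) :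
    Tendsto (fun n => StrongDual.toLp (W.gaussian t) 2 (L n)) atTop (𝓝 (W.ell t a)) :=
  (W.tendsto_ell ht a).comp (tendsto_comap_iff.2 hL)

/-- `a ↦ ℓ_a` as a linear map. -/
noncomputable def ellₗ (W : AbstractWienerSpace H B) {t : ℝ} (ht : 0 ≤ t) : H →ₗ[ℝ] Lp ℝ 2 (W.gaussian t) where
  toFun := W.ell t
  map_add' a b := by
    obtain ⟨L, hL⟩ := W.exists_seq_dualEmb_tendsto a
    obtain ⟨L', hL'⟩ := W.exists_seq_dualEmb_tendsto b
    have h := W.tendsto_toLp_ell ht (L := fun n => L n + L' n)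
      ((hL.add hL').congr fun n => (W.dualEmbₗ.map_add _ _).symm)
    exact tendsto_nhds_unique h (((W.tendsto_toLp_ell ht hL).add
      (W.tendsto_toLp_ell ht hL')).congr fun n => (map_add _ _ _).symm)
  map_smul' c a := by
    obtain ⟨L, hL⟩ := W.exists_seq_dualEmb_tendsto a
    have h := W.tendsto_toLp_ell ht (L := fun n => c • L n)
      ((hL.const_smul c).congr fun n => (W.dualEmbₗ.map_smul _ _).symm)
    exact tendsto_nhds_unique h (((W.tendsto_toLp_ell ht hL).const_smul c).congr
      fun n => (map_smul (StrongDual.toLp (W.gaussian t) 2) c (L n)).symm)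

@[simp] theorem ellₗ_apply (W : AbstractWienerSpace H B) {t : ℝ} (ht : 0 ≤ t) (a : H) :
    W.ellₗ ht a = W.ell t a := rfl

theorem norm_ell (W : AbstractWienerSpace H B) {t : ℝ} (ht : 0 ≤ t) (a : H) :
    ‖W.ell t a‖ = √t * ‖a‖ := by
  obtain ⟨L, hL⟩ := W.exists_seq_dualEmb_tendsto a
  exact tendsto_nhds_unique (W.tendsto_toLp_ell ht hL).norm
    ((hL.norm.const_mul √t).congr fun n => (W.norm_toLp_gaussian ht _).symm)

theorem ell_dualEmb (W : AbstractWienerSpace H B) {t : ℝ} (ht : 0 ≤ t) (L : StrongDual ℝ B) :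
    W.ell t (W.dualEmb L) =ᵐ[W.gaussian t] L := by
  have h := tendsto_nhds_unique
    (W.tendsto_toLp_ell ht (L := fun _ => L) tendsto_const_nhds) tendsto_const_nhds
  rw [h, StrongDual.toLp_apply (W.memLp_id_gaussian ht)]
  exact MemLp.coeFn_toLp _

theorem eLpNorm_one_ell_le (W : AbstractWienerSpace H B) {t : ℝ} (ht : 0 ≤ t) (a : H) :
    eLpNorm (W.ell t a) 1 (W.gaussian t) ≤ ENNReal.ofReal (√t * ‖a‖) := by
  refine (eLpNorm_le_eLpNorm_of_exponent_le (by norm_num : (1 : ℝ≥0∞) ≤ 2)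
    (Lp.aestronglyMeasurable _)).trans ?_
  rw [← W.norm_ell ht, ← Lp.enorm_def, ofReal_norm]

end Gaussian

/-! ### Coordinates of the extended projections -/

section Proj

variable {H B : Type*} [NormedAddCommGroup H] [InnerProductSpace ℝ H] [CompleteSpace H]
  [NormedAddCommGroup B] [NormedSpace ℝ B] [MeasurableSpace B] [BorelSpace B]

theorem aestronglyMeasurable_proj (W : AbstractWienerSpace H B) (t : ℝ) (E : Submodule ℝ H)
    [FiniteDimensional ℝ E] : AEStronglyMeasurable (W.proj t E) (W.gaussian t) := by
  unfold proj
  refine Finset.aestronglyMeasurable_fun_sum _ fun j _ => ?_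
  exact (Lp.aestronglyMeasurable _).smul_const _

variable [CompleteSpace B] [SecondCountableTopology B]

/-- Linearity of `ℓ` applied to the expansion of the projected vector. This frees `proj` from the
arbitrary orthonormal basis in its definition. -/
theorem inner_proj_ae (W : AbstractWienerSpace H B) {t : ℝ} (ht : 0 ≤ t) (E : Submodule ℝ H)
    [FiniteDimensional ℝ E] (f : H) :
    (fun y => ⟪f, W.proj t E y⟫) =ᵐ[W.gaussian t] W.ell t (E.starProjection f) := by
  have h1 : E.starProjection f = ∑ j, ⟪(stdOrthonormalBasis ℝ E j : H), f⟫ •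
      (stdOrthonormalBasis ℝ E j : H) := by
    rw [Submodule.starProjection_apply,
      (stdOrthonormalBasis ℝ E).orthogonalProjectionOnto_apply_eq_sum]
    simp
  have h2 : W.ell t (E.starProjection f) = ∑ j, ⟪(stdOrthonormalBasis ℝ E j : H), f⟫ •
      W.ell t (stdOrthonormalBasis ℝ E j : H) := by
    rw [h1, ← W.ellₗ_apply ht, map_sum]
    simp
  have h3 : ∀ᵐ y ∂(W.gaussian t), ∀ j,
      (⟪(stdOrthonormalBasis ℝ E j : H), f⟫ • W.ell t (stdOrthonormalBasis ℝ E j : H) :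
        Lp ℝ 2 (W.gaussian t)) y =
      ⟪(stdOrthonormalBasis ℝ E j : H), f⟫ * W.ell t (stdOrthonormalBasis ℝ E j : H) y :=
    ae_all_iff.2 fun j => Lp.coeFn_smul _ _
  rw [h2]
  filter_upwards [h3, Lp.coeFn_finsetSum Finset.univ fun j =>
    (⟪(stdOrthonormalBasis ℝ E j : H), f⟫ • W.ell t (stdOrthonormalBasis ℝ E j : H) :
      Lp ℝ 2 (W.gaussian t))] with y hy hy'
  rw [hy', Finset.sum_apply, proj, inner_sum]
  refine Finset.sum_congr rfl fun j _ => ?_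
  rw [hy, inner_smul_right, real_inner_comm, mul_comm]

end Proj

end AbstractWienerSpace

/-! ### Taylor estimates along a line -/

section LineDerivative

variable {E G : Type*} [NormedAddCommGroup E] [NormedSpace ℝ E]
  [NormedAddCommGroup G] [NormedSpace ℝ G]

theorem hasDerivAt_add_smul {f : E → G} {v : E} (hf : ∀ x, LineDifferentiableAt ℝ f x v)
    (x : E) (s : ℝ) : HasDerivAt (fun r : ℝ => f (x + r • v)) (lineDeriv ℝ f (x + s • v) v) s := by
  have h : HasDerivAt (fun r : ℝ => f (x + s • v + r • v)) (lineDeriv ℝ f (x + s • v) v) (s - s) := by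
    rw [sub_self]
    exact (hf (x + s • v)).hasLineDerivAt
  have h' := h.scomp_of_eq s ((hasDerivAt_id s).sub_const s) rfl
  rw [one_smul] at h'
  refine h'.congr_of_eventuallyEq (Eventually.of_forall fun r => ?_)
  simp [add_assoc, ← add_smul]

theorem norm_add_smul_sub_le {f : E → G} {v : E} {C : ℝ}
    (hf : ∀ x, LineDifferentiableAt ℝ f x v) (hC : ∀ x, ‖lineDeriv ℝ f x v‖ ≤ C)
    (x : E) (c : ℝ) : ‖f (x + c • v) - f x‖ ≤ C * |c| := by
  have h := convex_univ.norm_image_sub_le_of_norm_hasDerivWithin_le (𝕜 := ℝ)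
    (fun s _ => (hasDerivAt_add_smul hf x s).hasDerivWithinAt) (fun s _ => hC _)
    (Set.mem_univ 0) (Set.mem_univ c)
  simpa using h

/-- Mean value inequality for `s ↦ f (x + s v) - s f'(x)`: on the segment from `0` to `c` its
derivative is at most `C |s| ≤ C |c|`. The sharp factor `1/2` is not needed. -/
theorem norm_add_smul_sub_sub_le {f : E → G} {v : E} {C : ℝ}
    (hf : ∀ x, LineDifferentiableAt ℝ f x v)
    (hf' : ∀ x, LineDifferentiableAt ℝ (fun x => lineDeriv ℝ f x v) x v)
    (hC : ∀ x, ‖lineDeriv ℝ (fun x => lineDeriv ℝ f x v) x v‖ ≤ C) (x : E) (c : ℝ) :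
    ‖f (x + c • v) - f x - c • lineDeriv ℝ f x v‖ ≤ C * c ^ 2 := by
  have h0 : 0 ≤ C := (norm_nonneg _).trans (hC 0)
  have h := (convex_uIcc (0 : ℝ) c).norm_image_sub_le_of_norm_hasDerivWithin_le (𝕜 := ℝ)
    (f := fun s : ℝ => f (x + s • v) - s • lineDeriv ℝ f x v)
    (f' := fun s : ℝ => lineDeriv ℝ f (x + s • v) v - lineDeriv ℝ f x v) (C := C * |c|)
    (fun s _ => by
      have := (hasDerivAt_add_smul hf x s).sub ((hasDerivAt_id s).smul_const (lineDeriv ℝ f x v))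
      rw [one_smul] at this
      exact this.hasDerivWithinAt)
    (fun s hs => (norm_add_smul_sub_le hf' hC x s).trans <|
      mul_le_mul_of_nonneg_left (by simpa using Set.abs_sub_left_of_mem_uIcc hs) h0)
    Set.left_mem_uIcc Set.right_mem_uIcc
  have e : C * c ^ 2 = C * |c| * ‖c - 0‖ := by
    rw [sub_zero, Real.norm_eq_abs, mul_assoc, ← sq, sq_abs]
  rw [e]
  convert! h using 2
  simp [sub_right_comm]

end LineDerivative

/-! ### Lipschitz bounds summed over coordinates -/

section CoordinateLipschitz

variable {ι K : Type*} [NormedAddCommGroup K] [InnerProductSpace ℝ K]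

theorem enorm_add_sum_smul_sub_le {v : ι → K} {C : ι → ℝ} {F : K → ℂ}
    (hd : ∀ k x, LineDifferentiableAt ℝ F x (v k)) (hC : ∀ k x, ‖lineDeriv ℝ F x (v k)‖ ≤ C k)
    (x : K) (c : ι → ℝ) (s : Finset ι) :
    ‖F (x + ∑ k ∈ s, c k • v k) - F x‖ₑ ≤ ∑ k ∈ s, ENNReal.ofReal (C k) * ‖c k‖ₑ := by
  classical
  induction s using Finset.induction_on with
  | empty => simp
  | insert k s hk ih =>
    rw [Finset.sum_insert hk, Finset.sum_insert hk]
    have h : F (x + (c k • v k + ∑ j ∈ s, c j • v j)) - F x =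
        (F (x + ∑ j ∈ s, c j • v j + c k • v k) - F (x + ∑ j ∈ s, c j • v j))
          + (F (x + ∑ j ∈ s, c j • v j) - F x) := by
      rw [sub_add_sub_cancel, add_comm (c k • v k), add_assoc]
    rw [h]
    refine (enorm_add_le _ _).trans (add_le_add ?_ ih)
    rw [← ofReal_norm, Real.enorm_eq_ofReal_abs,
      ← ENNReal.ofReal_mul ((norm_nonneg _).trans (hC k 0))]
    exact ENNReal.ofReal_le_ofReal (norm_add_smul_sub_le (hd k) (hC k) _ _)

/-- Move from `y` to `x` by finite partial sums of the expansion of `x - y`, then pass to the limit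
by continuity of `F`. Values in `ℝ≥0∞` allow a divergent right-hand side. -/
theorem HilbertBasis.enorm_sub_le_tsum (b : HilbertBasis ι ℝ K) {C : ι → ℝ} {F : K → ℂ}
    (hF : Continuous F) (hd : ∀ k x, LineDifferentiableAt ℝ F x (b k))
    (hC : ∀ k x, ‖lineDeriv ℝ F x (b k)‖ ≤ C k) (x y : K) :
    ‖F x - F y‖ₑ ≤ ∑' k, ENNReal.ofReal (C k) * ‖⟪b k, x - y⟫‖ₑ := by
  have h : Tendsto (fun s : Finset ι => F (y + ∑ k ∈ s, ⟪b k, x - y⟫ • b k) - F y) atTop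
      (𝓝 (F x - F y)) := by
    have h1 : HasSum (fun k => ⟪b k, x - y⟫ • b k) (x - y) := by
      simpa only [b.repr_apply_apply] using b.hasSum_repr (x - y)
    have h2 : Tendsto (fun s : Finset ι => y + ∑ k ∈ s, ⟪b k, x - y⟫ • b k) atTop (𝓝 x) := by
      simpa using (tendsto_const_nhds (x := y)).add h1
    exact ((hF.tendsto x).comp h2).sub_const _
  refine le_of_tendsto' h.enorm fun s => ?_
  exact (enorm_add_sum_smul_sub_le hd hC y _ s).trans (ENNReal.sum_le_tsum s)

end CoordinateLipschitz

/-! ### Unmixed derivatives of symbols -/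

section SymbolClass

variable {H : Type*} [NormedAddCommGroup H] [InnerProductSpace ℝ H] {Γ : Type*}

/-- Lets the counts in `SymbolClass`, taken with `==` on `Γ ⊕ Γ`, be evaluated on constant lists. -/
instance Sum.instLawfulBEq {α β : Type*} [BEq α] [LawfulBEq α] [BEq β] [LawfulBEq β] :
    LawfulBEq (α ⊕ β) where
  eq_of_beq {a b} h := by
    cases a <;> cases b
    · exact congrArg _ (eq_of_beq h)
    · exact absurd h Bool.false_ne_true
    · exact absurd h Bool.false_ne_true
    · exact congrArg _ (eq_of_beq h)
  rfl {a} := by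
    cases a with
    | inl a => exact beq_self_eq_true a
    | inr a => exact beq_self_eq_true a

theorem SymbolClass.iterDeriv_replicate {e : HilbertBasis Γ ℝ H} {m : ℕ} {M : ℝ} {ε : Γ → ℝ}
    {F : WithLp 2 (H × H) → ℂ} (hF : F ∈ SymbolClass e m M ε) (k : Γ ⊕ Γ) {n : ℕ} (hn : n ≤ m) :
    IterDifferentiable e F (List.replicate n k) ∧ Continuous (iterDeriv e F (List.replicate n k)) ∧
      ∀ X, ‖iterDeriv e F (List.replicate n k) X‖ ≤ M * Sum.elim ε ε k ^ n := by
  classical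
  cases k with
  | inl j =>
    have h := hF (Finsupp.single j n) 0
      (fun i => ⟨(by rw [Finsupp.single_apply]; split_ifs <;> simp  : _ ≤ n).trans hn, by simp⟩)
      (List.replicate n (Sum.inl j))
      (fun i => by
        rw [List.count_replicate, List.count_replicate]
        simp [Finsupp.single_apply])
    simpa using h
  | inr j =>
    have h := hF 0 (Finsupp.single j n)
      (fun i => ⟨by simp, (by rw [Finsupp.single_apply]; split_ifs <;> simp  : _ ≤ n).trans hn⟩)
      (List.replicate n (Sum.inr j))
      (fun i => by
        rw [List.count_replicate, List.count_replicate]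
        simp [Finsupp.single_apply])
    simpa using h

end SymbolClass

/-! ### The Hilbert basis of `H²` -/

section PhaseBasis

variable {H : Type*} [NormedAddCommGroup H] [InnerProductSpace ℝ H] [CompleteSpace H] {Γ : Type*}

omit [CompleteSpace H] in
theorem orthonormal_phaseDir (e : HilbertBasis Γ ℝ H) : Orthonormal ℝ (phaseDir e) := by
  classical
  rw [orthonormal_iff_ite]
  have h := orthonormal_iff_ite.1 e.orthonormal
  rintro (i | i) (j | j) <;> simp [phaseDir, WithLp.prod_inner_apply, h]

/-- The Hilbert basis `(u_j), (v_j)` of `H²`. -/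
noncomputable def phaseBasis (e : HilbertBasis Γ ℝ H) : HilbertBasis (Γ ⊕ Γ) ℝ (WithLp 2 (H × H)) :=
  HilbertBasis.mkOfOrthogonalEqBot (orthonormal_phaseDir e) <| by
    rw [Submodule.eq_bot_iff]
    intro x hx
    have hx' : ∀ k, ⟪phaseDir e k, x⟫ = 0 := fun k => hx _ (Submodule.subset_span ⟨k, rfl⟩)
    have h0 : ∀ z : H, (∀ j, ⟪e j, z⟫ = 0) → z = 0 := fun z hz => by
      refine e.repr.injective ?_
      ext j
      simp [e.repr_apply_apply, hz]
    have h1 := h0 x.fst fun j => by simpa [phaseDir, WithLp.prod_inner_apply] using hx' (Sum.inl j)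
    have h2 := h0 x.snd fun j => by simpa [phaseDir, WithLp.prod_inner_apply] using hx' (Sum.inr j)
    exact (WithLp.equiv 2 (H × H)).injective (Prod.ext h1 h2)

@[simp] theorem phaseBasis_apply (e : HilbertBasis Γ ℝ H) (k : Γ ⊕ Γ) :
    phaseBasis e k = phaseDir e k := by
  simp [phaseBasis]

theorem AbstractWienerSpace.phaseDir_mem_range_dualEmb_sq {B : Type*} [NormedAddCommGroup B]
    [NormedSpace ℝ B] [MeasurableSpace B] (W : AbstractWienerSpace H B) (e : HilbertBasis Γ ℝ H)
    (he : ∀ j, e j ∈ Set.range W.dualEmb) (k : Γ ⊕ Γ) :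
    phaseDir e k ∈ Set.range W.sq.dualEmb := by
  cases k with
  | inl j =>
    obtain ⟨L, hL⟩ := he j
    refine ⟨L.comp (ContinuousLinearMap.fst ℝ B B), ext_inner_right ℝ fun x => ?_⟩
    rw [inner_dualEmb]
    simp [phaseDir, WithLp.prod_inner_apply, ← hL, inner_dualEmb, sq]
  | inr j =>
    obtain ⟨L, hL⟩ := he j
    refine ⟨L.comp (ContinuousLinearMap.snd ℝ B B), ext_inner_right ℝ fun x => ?_⟩
    rw [inner_dualEmb]
    simp [phaseDir, WithLp.prod_inner_apply, ← hL, inner_dualEmb, sq]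

end PhaseBasis

namespace AbstractWienerSpace

/-! ### Existence of the stochastic extension -/

section Extension

variable {H B : Type*} [NormedAddCommGroup H] [InnerProductSpace ℝ H] [CompleteSpace H]
  [NormedAddCommGroup B] [NormedSpace ℝ B] [MeasurableSpace B] [BorelSpace B]

theorem memLp_comp_proj (W : AbstractWienerSpace H B) (t : ℝ) {F : H → ℂ} {M : ℝ}
    (hF : Continuous F) (hM : ∀ x, ‖F x‖ ≤ M) (X : H) (E : Submodule ℝ H)
    [FiniteDimensional ℝ E] :
    MemLp (fun y => F (X + W.proj t E y)) 1 (W.gaussian t) :=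
  MemLp.of_bound ((hF.comp (continuous_const_add X)).comp_aestronglyMeasurable
    (W.aestronglyMeasurable_proj t E)) M (Eventually.of_forall fun _ => hM _)

variable [CompleteSpace B] [SecondCountableTopology B] {ι : Type*} [Countable ι]

/-- The coordinatewise Lipschitz bound holds almost everywhere in `y`; Tonelli then reduces the
estimate to the `L¹` norms of single variables `ℓ_a`. -/
theorem eLpNorm_comp_proj_sub_le (W : AbstractWienerSpace H B) {t : ℝ} (ht : 0 ≤ t)
    (b : HilbertBasis ι ℝ H) {C : ι → ℝ} {F : H → ℂ}
    (hF : Continuous F) (hd : ∀ k x, LineDifferentiableAt ℝ F x (b k))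
    (hC : ∀ k x, ‖lineDeriv ℝ F x (b k)‖ ≤ C k) (X : H) (E E' : Submodule ℝ H)
    [FiniteDimensional ℝ E] [FiniteDimensional ℝ E'] :
    eLpNorm (fun y => F (X + W.proj t E y) - F (X + W.proj t E' y)) 1 (W.gaussian t) ≤
      ∑' k, ENNReal.ofReal (C k * (√t * ‖E.starProjection (b k) - E'.starProjection (b k)‖)) := by
  rw [eLpNorm_one_eq_lintegral_enorm]
  let D : ι → H := fun k => E.starProjection (b k) - E'.starProjection (b k)
  -- Countability of `ι` gives one null set for all coordinates.
  have key : ∀ᵐ y ∂(W.gaussian t), ∀ k,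
      ⟪b k, (X + W.proj t E y) - (X + W.proj t E' y)⟫ = W.ell t (D k) y := by
    refine ae_all_iff.2 fun k => ?_
    have h : W.ell t (D k) = W.ell t (E.starProjection (b k)) - W.ell t (E'.starProjection (b k)) :=
      (W.ellₗ ht).map_sub _ _
    rw [h]
    filter_upwards [W.inner_proj_ae ht E (b k), W.inner_proj_ae ht E' (b k),
      Lp.coeFn_sub (W.ell t (E.starProjection (b k))) (W.ell t (E'.starProjection (b k)))]
      with y h1 h2 h3
    rw [h3, Pi.sub_apply, ← h1, ← h2, add_sub_add_left_eq_sub, inner_sub_right]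
  calc ∫⁻ y, ‖F (X + W.proj t E y) - F (X + W.proj t E' y)‖ₑ ∂(W.gaussian t)
      ≤ ∫⁻ y, ∑' k, ENNReal.ofReal (C k) * ‖W.ell t (D k) y‖ₑ ∂(W.gaussian t) := by
        refine lintegral_mono_ae ?_
        filter_upwards [key] with y hy
        simpa only [hy] using b.enorm_sub_le_tsum hF hd hC (X + W.proj t E y) (X + W.proj t E' y)
    _ = ∑' k, ENNReal.ofReal (C k) * eLpNorm (W.ell t (D k)) 1 (W.gaussian t) := by
        rw [lintegral_tsum fun k => ((Lp.aestronglyMeasurable _).enorm.const_mul _)]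
        refine tsum_congr fun k => ?_
        rw [lintegral_const_mul'' _ (Lp.aestronglyMeasurable _).enorm,
          eLpNorm_one_eq_lintegral_enorm]
    _ ≤ _ := by
        refine ENNReal.tsum_le_tsum fun k => ?_
        rw [ENNReal.ofReal_mul ((norm_nonneg _).trans (hC k 0))]
        gcongr
        exact W.eLpNorm_one_ell_le ht _

/-- Dominated convergence for series: projections are contractions and `‖b k‖ = 1`, so `2 √t C k`
dominates. The general filter serves both the Cauchy property and the comparison of two sequences.
-/
theorem tendsto_eLpNorm_comp_proj_sub (W : AbstractWienerSpace H B) {t : ℝ} (ht : 0 ≤ t)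
    (b : HilbertBasis ι ℝ H) {C : ι → ℝ} (hsum : Summable C) {F : H → ℂ}
    (hF : Continuous F) (hd : ∀ k x, LineDifferentiableAt ℝ F x (b k))
    (hC : ∀ k x, ‖lineDeriv ℝ F x (b k)‖ ≤ C k) (X : H) {J : Type*} {l : Filter J}
    {E E' : J → Submodule ℝ H} [∀ i, FiniteDimensional ℝ (E i)] [∀ i, FiniteDimensional ℝ (E' i)]
    (hE : ∀ x, Tendsto (fun i => (E i).starProjection x) l (𝓝 x))
    (hE' : ∀ x, Tendsto (fun i => (E' i).starProjection x) l (𝓝 x)) :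
    Tendsto (fun i => eLpNorm (fun y => F (X + W.proj t (E i) y) - F (X + W.proj t (E' i) y)) 1
      (W.gaussian t)) l (𝓝 0) := by
  have hC0 : ∀ k, 0 ≤ C k := fun k => (norm_nonneg _).trans (hC k 0)
  let a : J → ι → ℝ := fun i k =>
    C k * (√t * ‖(E i).starProjection (b k) - (E' i).starProjection (b k)‖)
  have ha0 : ∀ i k, 0 ≤ a i k := fun i k => mul_nonneg (hC0 k) (by positivity)
  have hab : ∀ i k, a i k ≤ C k * (√t * 2) := fun i k => by
    refine mul_le_mul_of_nonneg_left (mul_le_mul_of_nonneg_left ?_ (Real.sqrt_nonneg t)) (hC0 k)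
    have h1 : ‖b k‖ = 1 := b.orthonormal.1 k
    calc _ ≤ ‖(E i).starProjection (b k)‖ + ‖(E' i).starProjection (b k)‖ := norm_sub_le _ _
      _ ≤ ‖b k‖ + ‖b k‖ :=
        add_le_add ((E i).norm_starProjection_apply_le _) ((E' i).norm_starProjection_apply_le _)
      _ = 2 := by rw [h1]; norm_num
  have hbs : Summable fun k => C k * (√t * 2) := hsum.mul_right _
  have hlim : Tendsto (fun i => ∑' k, a i k) l (𝓝 0) := by
    have h := tendsto_tsum_of_dominated_convergence (f := a) (g := fun _ => (0 : ℝ)) (𝓕 := l) hbs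
      (fun k => by simpa using (((hE (b k)).sub (hE' (b k))).norm.const_mul √t).const_mul (C k))
      (Eventually.of_forall fun i k => by
        rw [Real.norm_of_nonneg (ha0 i k)]
        exact hab i k)
    simpa using h
  refine tendsto_of_tendsto_of_tendsto_of_le_of_le tendsto_const_nhds
    (by simpa using ENNReal.tendsto_ofReal hlim) (fun _ => zero_le) fun i => ?_
  refine (W.eLpNorm_comp_proj_sub_le ht b hF hd hC X (E i) (E' i)).trans_eq ?_
  exact (ENNReal.ofReal_tsum_of_nonneg (ha0 i)
    (hbs.of_nonneg_of_le (ha0 i) (hab i))).symm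

omit [CompleteSpace H] in
theorem _root_.Submodule.starProjection_tendsto_self_of_dense {E : ℕ → Submodule ℝ H}
    [∀ n, FiniteDimensional ℝ (E n)] (hE : Monotone E) (hd : Dense (⋃ n, (E n : Set H))) (x : H) :
    Tendsto (fun n => (E n).starProjection x) atTop (𝓝 x) := by
  refine Submodule.starProjection_tendsto_self E hE x fun z _ => ?_
  refine closure_mono ?_ (hd z)
  exact Set.iUnion_subset fun n => SetLike.coe_subset_coe.2 (le_iSup E n)

omit [CompleteSpace H] in
theorem _root_.HilbertBasis.exists_seq_finset_span (b : HilbertBasis ι ℝ H) :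
    ∃ s : ℕ → Finset ι, Monotone (fun n => Submodule.span ℝ (b '' (s n : Set ι))) ∧
      Dense (⋃ n, (Submodule.span ℝ (b '' (s n : Set ι)) : Set H)) := by
  obtain ⟨s, hs, hs'⟩ := exists_seq_monotone_tendsto_atTop_atTop (Finset ι)
  refine ⟨s, fun m n h => Submodule.span_mono (Set.image_mono (hs h)), fun x => ?_⟩
  have h : Tendsto (fun n => ∑ k ∈ s n, b.repr x k • b k) atTop (𝓝 x) :=
    (b.hasSum_repr x).comp hs'
  refine mem_closure_of_tendsto h (Eventually.of_forall fun n => Set.mem_iUnion.2 ⟨n, ?_⟩)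
  exact Submodule.sum_mem _ fun k hk =>
    Submodule.smul_mem _ _ (Submodule.subset_span ⟨k, hk, rfl⟩)

theorem exists_isStochasticExtension (W : AbstractWienerSpace H B) {t : ℝ} (ht : 0 ≤ t)
    (b : HilbertBasis ι ℝ H) {C : ι → ℝ} (hsum : Summable C) {F : H → ℂ} {M : ℝ}
    (hF : Continuous F) (hM : ∀ x, ‖F x‖ ≤ M) (hd : ∀ k x, LineDifferentiableAt ℝ F x (b k))
    (hC : ∀ k x, ‖lineDeriv ℝ F x (b k)‖ ≤ C k) (X : H) :
    ∃ G : B → ℂ, W.IsStochasticExtension t (fun Y => F (X + Y)) G := by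
  obtain ⟨s, hs, hsd⟩ := b.exists_seq_finset_span
  set E : ℕ → Submodule ℝ H := fun n => Submodule.span ℝ (b '' (s n : Set ι))
  have hfin : ∀ n, FiniteDimensional ℝ (E n) := fun n =>
    FiniteDimensional.span_of_finite ℝ ((s n).finite_toSet.image _)
  have hEx := Submodule.starProjection_tendsto_self_of_dense hs hsd
  have hL : ∀ n, MemLp (fun y => F (X + W.proj t (E n) y)) 1 (W.gaussian t) :=
    fun n => W.memLp_comp_proj t hF hM X (E n)
  have hcau : CauchySeq fun n => (hL n).toLp := by
    rw [cauchySeq_iff_tendsto_dist_atTop_0]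
    have h := W.tendsto_eLpNorm_comp_proj_sub ht b hsum hF hd hC X (l := atTop)
      (E := fun p : ℕ × ℕ => E p.1) (E' := fun p : ℕ × ℕ => E p.2)
      (fun x => (hEx x).comp (by rw [← prod_atTop_atTop_eq]; exact tendsto_fst))
      (fun x => (hEx x).comp (by rw [← prod_atTop_atTop_eq]; exact tendsto_snd))
    have h' := (ENNReal.tendsto_toReal ENNReal.zero_ne_top).comp h
    rw [ENNReal.toReal_zero] at h'
    refine h'.congr fun p => ?_
    rw [Function.comp_apply, dist_edist, Lp.edist_toLp_toLp]
    rfl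
  obtain ⟨G, hG⟩ := cauchySeq_tendsto_of_complete hcau
  have hG' : Tendsto (fun n => eLpNorm (fun y => F (X + W.proj t (E n) y) - G y) 1 (W.gaussian t))
      atTop (𝓝 0) := by
    refine (tendsto_iff_edist_tendsto_0.1 hG).congr fun n => ?_
    rw [Lp.edist_def]
    refine eLpNorm_congr_ae ?_
    filter_upwards [(hL n).coeFn_toLp] with y hy
    simp [hy]
  refine ⟨G, Lp.memLp G, fun E' _ hE' hd' => ⟨fun n => W.memLp_comp_proj t hF hM X (E' n), ?_⟩⟩
  -- An arbitrary sequence `E'` is compared with the reference sequence `E` that defined `G`.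
  have h := W.tendsto_eLpNorm_comp_proj_sub ht b hsum hF hd hC X (l := atTop)
    (Submodule.starProjection_tendsto_self_of_dense hE' hd') hEx
  have h2 := h.add hG'
  rw [add_zero] at h2
  refine tendsto_of_tendsto_of_tendsto_of_le_of_le tendsto_const_nhds h2
    (fun _ => zero_le) fun n => ?_
  have hL' := W.memLp_comp_proj t hF hM X (E' n)
  have he : (fun y => F (X + W.proj t (E' n) y) - G y) =
      (fun y => F (X + W.proj t (E' n) y) - F (X + W.proj t (E n) y)) +
        fun y => F (X + W.proj t (E n) y) - G y := by
    ext y; simp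
  rw [he]
  exact eLpNorm_add_le (hL'.sub (hL n)).1 ((hL n).sub (Lp.memLp G)).1 le_rfl

/-- The orthonormal basis chosen in `proj` need not consist of the `b k`, so both sides are compared
through their coordinates in `b`. -/
theorem proj_ae_eq_sum (W : AbstractWienerSpace H B) {t : ℝ} (ht : 0 ≤ t)
    (b : HilbertBasis ι ℝ H) {L : ι → StrongDual ℝ B} (hL : ∀ k, W.dualEmb (L k) = b k)
    (s : Finset ι) (E : Submodule ℝ H) [FiniteDimensional ℝ E]
    (hE : E = Submodule.span ℝ (b '' (s : Set ι))) :
    W.proj t E =ᵐ[W.gaussian t] fun y => ∑ k ∈ s, L k y • b k := by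
  classical
  have hi := orthonormal_iff_ite.1 b.orthonormal
  have h : ∀ᵐ y ∂(W.gaussian t), ∀ k, ⟪b k, W.proj t E y⟫ = if k ∈ s then L k y else 0 := by
    refine ae_all_iff.2 fun k => ?_
    split_ifs with hk
    · have h1 : E.starProjection (b k) = b k := by
        rw [Submodule.starProjection_eq_self_iff, hE]
        exact Submodule.subset_span ⟨k, hk, rfl⟩
      filter_upwards [W.inner_proj_ae ht E (b k), W.ell_dualEmb ht (L k)] with y hy hy'
      rw [hy, h1, ← hy', hL]
    · have h1 : E.starProjection (b k) = 0 := by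
        rw [Submodule.starProjection_apply_eq_zero_iff, hE, Submodule.mem_orthogonal]
        intro u hu
        induction hu using Submodule.span_induction with
        | mem u hu =>
          obtain ⟨j, hj, rfl⟩ := hu
          rw [hi, if_neg fun hjk => hk (by rwa [← hjk])]
        | zero => simp
        | add u v _ _ hu hv => rw [inner_add_left, hu, hv, add_zero]
        | smul c u _ hu => rw [inner_smul_left, hu, mul_zero]
      have h2 : W.ell t 0 = 0 := (W.ellₗ ht).map_zero
      filter_upwards [W.inner_proj_ae ht E (b k), Lp.coeFn_zero ℝ 2 (W.gaussian t)] with y hy hy'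
      rw [hy, h1, h2, hy']
      rfl
  filter_upwards [h] with y hy
  refine b.repr.injective ?_
  ext k
  rw [b.repr_apply_apply, b.repr_apply_apply, hy, inner_sum]
  simp [inner_smul_right, hi]

end Extension

/-! ### Reflection symmetry and the heat operator -/

section Heat

variable {H B : Type*} [NormedAddCommGroup H] [InnerProductSpace ℝ H] [CompleteSpace H]
  [NormedAddCommGroup B] [NormedSpace ℝ B] [MeasurableSpace B] [BorelSpace B]

/-- The characteristic function depends only on a norm in `H`; orthogonality removes the cross term,
and what remains is even in `L`. -/
theorem map_prod_neg_gaussian (W : AbstractWienerSpace H B) {t : ℝ} (ht : 0 ≤ t)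
    {V : Type*} [NormedAddCommGroup V] [NormedSpace ℝ V] [CompleteSpace V]
    [SecondCountableTopology V] [MeasurableSpace V] [BorelSpace V]
    (L : StrongDual ℝ B) (T : B →L[ℝ] V)
    (h : ∀ f : StrongDual ℝ V, ⟪W.dualEmb L, W.dualEmb (f.comp T)⟫ = 0) :
    (W.gaussian t).map (L.prod T) = (W.gaussian t).map ((-L).prod T) := by
  have h1 := Measure.isProbabilityMeasure_map (μ := W.gaussian t) (f := L.prod T) (by fun_prop)
  have h2 := Measure.isProbabilityMeasure_map (μ := W.gaussian t) (f := (-L).prod T) (by fun_prop)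
  refine Measure.ext_of_charFunDual (funext fun f => ?_)
  rw [charFunDual_map, charFunDual_map, W.charFunDual_gaussian ht, W.charFunDual_gaussian ht]
  have key : ∀ r : ℝ, W.dualEmb (f.comp ((r • L).prod T)) =
      (r * f (1, 0)) • W.dualEmb L +
        W.dualEmb ((f.comp (ContinuousLinearMap.inr ℝ ℝ V)).comp T) := fun r => by
    rw [← dualEmbₗ_apply, ← dualEmbₗ_apply, ← dualEmbₗ_apply, ← map_smul, ← map_add]
    congr 1
    ext y
    have : ((r * L y, T y) : ℝ × V) = (r * L y) • ((1, 0) : ℝ × V) + (0, T y) := by simp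
    simp only [ContinuousLinearMap.comp_apply, ContinuousLinearMap.prod_apply,
      smul_apply, smul_eq_mul, add_apply,
      ContinuousLinearMap.inr_apply]
    rw [this, map_add, map_smul, smul_eq_mul]
    ring
  have hn : ∀ r : ℝ, ‖W.dualEmb (f.comp ((r • L).prod T))‖ ^ 2 =
      (r * f (1, 0)) ^ 2 * ‖W.dualEmb L‖ ^ 2 +
        ‖W.dualEmb ((f.comp (ContinuousLinearMap.inr ℝ ℝ V)).comp T)‖ ^ 2 := fun r => by
    rw [key, norm_add_sq_real, inner_smul_left, h, norm_smul, mul_pow, Real.norm_eq_abs, sq_abs]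
    simp
  have e1 := hn 1
  have e2 := hn (-1)
  rw [one_smul] at e1
  have hneg : (-1 : ℝ) • L = -L := by ext; simp
  rw [hneg] at e2
  rw [e1, e2]
  ring_nf

/-- Reflecting `L` shows that the integral equals its own negative. -/
theorem integral_dual_smul_eq_zero (W : AbstractWienerSpace H B) {t : ℝ} (ht : 0 ≤ t)
    {V : Type*} [NormedAddCommGroup V] [NormedSpace ℝ V] [CompleteSpace V]
    [SecondCountableTopology V] (L : StrongDual ℝ B) (T : B →L[ℝ] V)
    (h : ∀ f : StrongDual ℝ V, ⟪W.dualEmb L, W.dualEmb (f.comp T)⟫ = 0)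
    {g : V → ℂ} (hg : Continuous g) : ∫ y, L y • g (T y) ∂(W.gaussian t) = 0 := by
  borelize V
  have hc : Continuous fun p : ℝ × V => p.1 • g p.2 := by fun_prop
  have e1 : ∫ p, p.1 • g p.2 ∂((W.gaussian t).map (L.prod T)) =
      ∫ y, L y • g (T y) ∂(W.gaussian t) :=
    integral_map (by fun_prop) hc.aestronglyMeasurable
  have e2 : ∫ p, p.1 • g p.2 ∂((W.gaussian t).map ((-L).prod T)) =
      ∫ y, (-L y) • g (T y) ∂(W.gaussian t) :=
    integral_map (by fun_prop) hc.aestronglyMeasurable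
  rw [W.map_prod_neg_gaussian ht L T h, e2] at e1
  simp only [neg_smul, integral_neg] at e1
  exact self_eq_neg.1 e1.symm

variable [CompleteSpace B] [SecondCountableTopology B] [TopologicalSpace.SeparableSpace H]
  {ι : Type*}

/-- Each new direction `b k` is orthogonal to those already summed in `T`, so the first-order Taylor
term has mean zero and the step costs only `D k` times the variance `t`. -/
theorem norm_integral_add_sum_sub_le (W : AbstractWienerSpace H B) {t : ℝ} (ht : 0 ≤ t)
    (b : HilbertBasis ι ℝ H) {L : ι → StrongDual ℝ B} (hL : ∀ k, W.dualEmb (L k) = b k)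
    {C D : ι → ℝ} {F : H → ℂ} {M : ℝ} (hF : Continuous F) (hM : ∀ x, ‖F x‖ ≤ M)
    (hd : ∀ k x, LineDifferentiableAt ℝ F x (b k))
    (hC : ∀ k x, ‖lineDeriv ℝ F x (b k)‖ ≤ C k)
    (hdc : ∀ k, Continuous fun x => lineDeriv ℝ F x (b k))
    (hd' : ∀ k x, LineDifferentiableAt ℝ (fun x => lineDeriv ℝ F x (b k)) x (b k))
    (hD : ∀ k x, ‖lineDeriv ℝ (fun x => lineDeriv ℝ F x (b k)) x (b k)‖ ≤ D k)
    (X : H) (s : Finset ι) :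
    ‖∫ y, F (X + ∑ k ∈ s, L k y • b k) ∂(W.gaussian t) - F X‖ ≤ ∑ k ∈ s, D k * t := by
  classical
  have : SecondCountableTopology H := UniformSpace.secondCountable_of_separable H
  have hi := orthonormal_iff_ite.1 b.orthonormal
  induction s using Finset.induction_on with
  | empty => simp
  | insert k s hk ih =>
    let T : B →L[ℝ] H := ∑ j ∈ s, (L j).smulRight (b j)
    have hT : ∀ y, ∑ j ∈ s, L j y • b j = T y := fun y => by simp [T]
    simp_rw [Finset.sum_insert hk, hT] at ih ⊢
    -- Taylor remainder in the direction `b k`, based at the random point `X + T y`.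
    let R : B → ℂ := fun y =>
      F (X + T y + L k y • b k) - F (X + T y) - L k y • lineDeriv ℝ F (X + T y) (b k)
    have hzero : ∫ y, L k y • lineDeriv ℝ F (X + T y) (b k) ∂(W.gaussian t) = 0 := by
      refine W.integral_dual_smul_eq_zero ht (L k) T (fun f => ?_)
        ((hdc k).comp (continuous_const_add X))
      have hf : W.dualEmb (f.comp T) = ∑ j ∈ s, f (b j) • b j := by
        have : f.comp T = ∑ j ∈ s, f (b j) • L j := by
          ext y
          simp [T, mul_comm]
        rw [this, ← dualEmbₗ_apply, map_sum]
        simp [hL]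
      rw [hf, hL, inner_sum]
      simp [inner_smul_right, hi, hk]
    have hI1 : Integrable (fun y => F (X + T y)) (W.gaussian t) :=
      Integrable.of_bound (by fun_prop) M (Eventually.of_forall fun _ => hM _)
    have hI2 : Integrable (fun y => F (X + T y + L k y • b k)) (W.gaussian t) :=
      Integrable.of_bound (by fun_prop) M (Eventually.of_forall fun _ => hM _)
    have hI3 : Integrable (fun y => L k y • lineDeriv ℝ F (X + T y) (b k)) (W.gaussian t) := by
      have hm : Continuous fun y => lineDeriv ℝ F (X + T y) (b k) :=
        (hdc k).comp (by fun_prop)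
      exact ((W.memLp_dual_gaussian ht (L k)).integrable (by norm_num)).smul_bdd
        (C k) hm.aestronglyMeasurable (Eventually.of_forall fun _ => hC k _)
    have hsplit : ∫ y, F (X + (L k y • b k + T y)) ∂(W.gaussian t) - F X =
        ∫ y, R y ∂(W.gaussian t) + (∫ y, F (X + T y) ∂(W.gaussian t) - F X) := by
      have : ∀ y, F (X + (L k y • b k + T y)) = F (X + T y + L k y • b k) := fun y => by
        rw [add_comm (L k y • b k), add_assoc]
      simp_rw [this]
      have hR : ∫ y, R y ∂(W.gaussian t) = _ := integral_sub (hI2.sub hI1) hI3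
      have hR' := integral_sub hI2 hI1
      rw [hR, hR', hzero]
      ring
    have hR : ‖∫ y, R y ∂(W.gaussian t)‖ ≤ D k * t := by
      have h1 : ‖b k‖ = 1 := b.orthonormal.1 k
      calc ‖∫ y, R y ∂(W.gaussian t)‖ ≤ ∫ y, D k * L k y ^ 2 ∂(W.gaussian t) :=
            norm_integral_le_of_norm_le ((W.memLp_dual_gaussian ht (L k)).integrable_sq.const_mul _)
              (Eventually.of_forall fun y => norm_add_smul_sub_sub_le (hd k) (hd' k) (hD k) _ _)
        _ = D k * t := by
            rw [integral_const_mul, W.integral_dual_gaussian_sq ht, hL, h1]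
            ring
    rw [hsplit]
    exact (norm_add_le _ _).trans (add_le_add hR ih)

variable [Countable ι]

theorem norm_heatOp_sub_le (W : AbstractWienerSpace H B) {t : ℝ} (ht : 0 ≤ t)
    (b : HilbertBasis ι ℝ H) (hb : ∀ k, b k ∈ Set.range W.dualEmb)
    {C D : ι → ℝ} (hsC : Summable C) (hsD : Summable D)
    {F : H → ℂ} {M : ℝ} (hF : Continuous F) (hM : ∀ x, ‖F x‖ ≤ M)
    (hd : ∀ k x, LineDifferentiableAt ℝ F x (b k))
    (hC : ∀ k x, ‖lineDeriv ℝ F x (b k)‖ ≤ C k)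
    (hdc : ∀ k, Continuous fun x => lineDeriv ℝ F x (b k))
    (hd' : ∀ k x, LineDifferentiableAt ℝ (fun x => lineDeriv ℝ F x (b k)) x (b k))
    (hD : ∀ k x, ‖lineDeriv ℝ (fun x => lineDeriv ℝ F x (b k)) x (b k)‖ ≤ D k) (X : H) :
    ‖W.heatOp t F X - F X‖ ≤ (∑' k, D k) * t := by
  choose L hL using hb
  obtain ⟨G, hG⟩ := W.exists_isStochasticExtension ht b hsC hF hM hd hC X
  obtain ⟨s, hs, hsd⟩ := b.exists_seq_finset_span
  set E : ℕ → Submodule ℝ H := fun n => Submodule.span ℝ (b '' (s n : Set ι))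
  have hfin : ∀ n, FiniteDimensional ℝ (E n) := fun n =>
    FiniteDimensional.span_of_finite ℝ ((s n).finite_toSet.image _)
  obtain ⟨hm, hlim⟩ := hG.2 E hs hsd
  -- `L¹` convergence along spans of basis vectors carries the uniform finite-dimensional bound to
  -- the extension.
  have hint := tendsto_integral_of_L1' G hG.1.1
    (Eventually.of_forall fun n => memLp_one_iff_integrable.1 (hm n)) hlim
  rw [heatOp_eq hG]
  refine le_of_tendsto' (hint.sub_const (F X)).norm fun n => ?_
  have hae : ∫ y, F (X + W.proj t (E n) y) ∂(W.gaussian t) =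
      ∫ y, F (X + ∑ k ∈ s n, L k y • b k) ∂(W.gaussian t) := by
    refine integral_congr_ae ?_
    filter_upwards [W.proj_ae_eq_sum ht b hL (s n) (E n) rfl] with y hy
    rw [hy]
  rw [hae]
  refine (W.norm_integral_add_sum_sub_le ht b hL hF hM hd hC hdc hd' hD X (s n)).trans ?_
  rw [← Finset.sum_mul]
  gcongr
  exact hsD.sum_le_tsum _ fun k _ => (norm_nonneg _).trans (hD k 0)

end Heat

end AbstractWienerSpace

theorem proposition2p3 {H B Γ : Type*}
    [NormedAddCommGroup H] [InnerProductSpace ℝ H] [CompleteSpace H]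
    [TopologicalSpace.SeparableSpace H]
    [NormedAddCommGroup B] [NormedSpace ℝ B] [CompleteSpace B]
    [SecondCountableTopology B] [MeasurableSpace B] [BorelSpace B]
    (W : AbstractWienerSpace H B)
    [Countable Γ] (e : HilbertBasis Γ ℝ H) (he : ∀ j, e j ∈ Set.range W.dualEmb)
    (M : ℝ) (hM : 0 ≤ M) (ε : Γ → ℝ) (hε : ∀ j, 0 ≤ ε j) (hs : Summable ε)
    (F : WithLp 2 (H × H) → ℂ) (hF : F ∈ SymbolClass e 4 M ε) :
    ∃ C : ℝ, 0 < C ∧ ∀ (X : WithLp 2 (H × H)) (t : ℝ), 0 < t → t < 1 →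
      (∃ G : B × B → ℂ, W.sq.IsStochasticExtension t (fun Y => F (X + Y)) G) ∧
      ‖W.sq.heatOp t F X - F X‖ ≤ C * t := by
  have : SecondCountableTopology H := UniformSpace.secondCountable_of_separable H
  have hη0 : ∀ k, 0 ≤ Sum.elim ε ε k := by rintro (j | j) <;> exact hε j
  have hη : Summable (Sum.elim ε ε) := Summable.sum (Sum.elim ε ε) hs hs
  have hη2 : Summable fun k => Sum.elim ε ε k ^ 2 := by
    -- Each term is at most the total sum `S`, so its square is at most `S` times the term.
    refine (hη.mul_left (∑' k, Sum.elim ε ε k)).of_nonneg_of_le (fun k => sq_nonneg _) fun k => ?_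
    rw [sq]
    exact mul_le_mul_of_nonneg_right (hη.le_tsum k fun i _ => hη0 i) (hη0 k)
  obtain ⟨-, hFc, hbd⟩ : True ∧ Continuous F ∧ ∀ X, ‖F X‖ ≤ M := by
    simpa [IterDifferentiable, iterDeriv] using hF 0 0 (by simp) [] (by simp)
  have h1 := fun k => SymbolClass.iterDeriv_replicate hF k (n := 1) (by norm_num)
  have h2 := fun k => SymbolClass.iterDeriv_replicate hF k (n := 2) (by norm_num)
  have hd : ∀ k x, LineDifferentiableAt ℝ F x (phaseBasis e k) := fun k x => by
    simpa [iterDeriv] using (h1 k).1.2 x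
  have hC : ∀ k x, ‖lineDeriv ℝ F x (phaseBasis e k)‖ ≤ M * Sum.elim ε ε k := fun k x => by
    simpa [iterDeriv] using (h1 k).2.2 x
  have hdc : ∀ k, Continuous fun x => lineDeriv ℝ F x (phaseBasis e k) := fun k => by
    simpa [iterDeriv] using (h1 k).2.1
  have hd' : ∀ k x, LineDifferentiableAt ℝ (fun x => lineDeriv ℝ F x (phaseBasis e k)) x
      (phaseBasis e k) := fun k x => by
    simpa [iterDeriv] using (h2 k).1.2 x
  have hD : ∀ k x, ‖lineDeriv ℝ (fun x => lineDeriv ℝ F x (phaseBasis e k)) x (phaseBasis e k)‖ ≤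
      M * Sum.elim ε ε k ^ 2 := fun k x => by
    simpa [iterDeriv] using (h2 k).2.2 x
  have hb : ∀ k, phaseBasis e k ∈ Set.range W.sq.dualEmb := fun k => by
    rw [phaseBasis_apply]
    exact W.phaseDir_mem_range_dualEmb_sq e he k
  have hpos : 0 ≤ ∑' k, M * Sum.elim ε ε k ^ 2 := tsum_nonneg fun k => by positivity
  -- The `+ 1` keeps the constant positive even when the sum vanishes.
  refine ⟨∑' k, M * Sum.elim ε ε k ^ 2 + 1, by positivity, fun X t ht _ => ⟨?_, ?_⟩⟩
  · exact W.sq.exists_isStochasticExtension ht.le (phaseBasis e) (hη.mul_left M) hFc hbd hd hC X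
  · refine (W.sq.norm_heatOp_sub_le ht.le (phaseBasis e) hb (hη.mul_left M) (hη2.mul_left M)
      hFc hbd hd hC hdc hd' hD X).trans ?_
    gcongr
    linarith
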